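/- **Definitions.** For an integer $K_f\ge 1$ let $\mathcal F(K_f,W_f,S,B)$ be the class of functions $$(A_{K_f}\,\mathrm{ReLU}[\cdot]+b_{K_f})\circ\cdots\circ(A_2\,\mathrm{ReLU}[\cdot]+b_2)\circ(A_1x+b_1),\qquad A_i\in\mathbb R^{d_{i+1}\times d_i},\ b_i\in\mathbb R^{d_{i+1}},$$ with all dimensions $d_1,\dots,d_{K_f+1}$ at most $W_f$, all entries of all $A_i,b_i$ at most $B$ in absolute value, and at most $S$ nonzero entries in total. For $\lambda>0$, $\mathrm{Softmax}_\lambda$ acts on each column $u$ of a matrix by $\mathrm{Softmax}_\lambda(u)_i=e^{\lambda u_i}/\sum_j e^{\lambda u_j}$. An $H$-head attention layer is a map $$\mathrm{Attn}(Z)=\sum_{h=1}^H W_V^{(h)}Z\,\mathrm{Softmax}_\lambda\big((W_K^{(h)}Z)^\top W_Q^{(h)}Z\big),\qquad W_K^{(h)},W_Q^{(h)}\in\mathbb R^{d_h\times d_{\rm in}},\ W_V^{(h)}\in\mathbb R^{d_{\rm out}\times d_{\rm in}}.$$ For $X\in\mathbb R^{d\times n}$ the preprocessing layer appends a zero token and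 the positional encoding, $$P(X)=\begin{bmatrix}X&0\\ I_n&0\\ 0&1\end{bmatrix}\in\mathbb R^{(d+n+1)\times(n+1)},$$ and the truncation layer $T$ deletes the last column. $\mathcal T(H,W,K,C_{KQ},C_V)$ is the class of maps $T\circ\mathrm{Attn}_K\circ\cdots\circ\mathrm{Attn}_1\circ P$ with $K$ attention layers of $H$ heads each, all with the same inverse temperature $\lambda$, in which all token dimensions and head dimensions are at most $W$, and $\|(W_K)^\top W_Q\|_F\le C_{KQ}$ and $\|W_V\|_F\le C_V$ for every head of every layer. For a matrix $X=(x_1,\dots,x_n)$ put $\mathrm{vec}(X)=(x_1^\top,\dots,x_n^\top)$. **Theorem (Approximating Multi-Layer ReLU Networks by Transformer).** Let $d,n\ge 1$, $q\ge0$, $B>0$, $C_X>0$ and $\epsilon\in(0,1)$. For every $f:\mathbb R^{dn}\to\mathbb R^{qn}$ in $\mathcal F(K_f,W_f,S,B)$ there exist $\lambda>0$ and $g\in\mathcal T(H,W,K,C_{KQ},C_V)$, $g:\mathbb R^{d\times n}\to\mathbb R^{q\times n}$, with $K=3K_f$, i.e. $g=T\circ\mathrm{Attn}_{3K_f}\circ\cdots\circ\mathrm{Attn}_1\circ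 P$, such that $$\|g(X)-f(\mathrm{vec}(X))\|_{\max}\le\epsilon\qquad\text{for all }X\in[-C_X,C_X]^{d\times n},$$ where $f(\mathrm{vec}(X))\in\mathbb R^{qn}$ is read as the $q\times n$ matrix whose $\mathrm{vec}$ it is. Moreover, if $C_X\ge1$ and $B\ge 1$, the same $g$ satisfies $$H=O(W_f),\quad W=O(W_f),\quad K=O(K_f),\quad C_V=O(B\sqrt{W_f}),$$ $$C_{KQ}=O\Big(\sqrt{K_f\ln\tfrac{K_fW_fBC_X}{\epsilon}}\Big),\qquad \lambda=O\Big(\frac{K_f^2W_f^{K_f+1}B^{K_f}\ln(K_fW_fBC_X/\epsilon)}{\epsilon}\Big),$$ where each $O(\cdot)$ is an upper bound up to a factor $c\,(dn)^a$ with absolute constants $c>0$, $a\in\mathbb N$ (polynomial factors in $d$ and $n$ are hidden). -/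

import Mathlib

/-! ### ReLU networks -/

/-- Coordinate-wise ReLU activation. -/
noncomputable def reluVec {p : ℕ} (v : Fin p → ℝ) : Fin p → ℝ :=
  fun i => max (v i) 0

/-- `ReLUNet m K p` : the parameters of a `K`-layer ReLU network with input dimension `m` and
output dimension `p`, i.e. matrices and biases `(A₁, b₁), …, (A_K, b_K)` with `K ≥ 1`. -/
inductive ReLUNet (m : ℕ) : ℕ → ℕ → Type
  | affine {p : ℕ} (A : Matrix (Fin p) (Fin m) ℝ) (b : Fin p → ℝ) : ReLUNet m 1 p
  | layer {K p q : ℕ} (N : ReLUNet m K p) (A : Matrix (Fin q) (Fin p) ℝ) (b : Fin q → ℝ) :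
      ReLUNet m (K + 1) q

namespace ReLUNet

/-- The realized function
`(A_K ReLU[·] + b_K) ∘ ⋯ ∘ (A₂ ReLU[·] + b₂) ∘ (A₁ x + b₁)`. -/
noncomputable def eval {m : ℕ} : {K p : ℕ} → ReLUNet m K p → (Fin m → ℝ) → (Fin p → ℝ)
  | _, _, affine A b => fun x => A.mulVec x + b
  | _, _, layer N A b => fun x => A.mulVec (reluVec (N.eval x)) + b

/-- The largest of the layer dimensions, input and output dimension included. -/
def width {m : ℕ} : {K p : ℕ} → ReLUNet m K p → ℕ
  | _, p, affine _ _ => max m p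
  | _, q, layer N _ _ => max N.width q

/-- Every entry of every weight matrix and of every bias is at most `B` in absolute value. -/
def WeightsLE {m : ℕ} (B : ℝ) : {K p : ℕ} → ReLUNet m K p → Prop
  | _, _, affine A b => (∀ i j, |A i j| ≤ B) ∧ ∀ i, |b i| ≤ B
  | _, _, layer N A b => N.WeightsLE B ∧ (∀ i j, |A i j| ≤ B) ∧ ∀ i, |b i| ≤ B

/-- The total number of nonzero entries of the weight matrices and biases. -/
noncomputable def numNonzero {m : ℕ} : {K p : ℕ} → ReLUNet m K p → ℕ
  | _, _, affine A b => {ij : _ × _ | A ij.1 ij.2 ≠ 0}.ncard + {i | b i ≠ 0}.ncard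
  | _, _, layer N A b =>
      N.numNonzero + ({ij : _ × _ | A ij.1 ij.2 ≠ 0}.ncard + {i | b i ≠ 0}.ncard)

end ReLUNet

/-- The class `𝓕(K, W, S, B)` of functions `ℝ^m → ℝ^p` realized by `K`-layer ReLU networks. -/
def reluClass (m p K W S : ℕ) (B : ℝ) : Set ((Fin m → ℝ) → (Fin p → ℝ)) :=
  {f | ∃ N : ReLUNet m K p, N.width ≤ W ∧ N.WeightsLE B ∧ N.numNonzero ≤ S ∧ N.eval = f}

/-! ### Softmax attention networks -/

/-- Column-wise softmax with inverse temperature `lam`. -/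
noncomputable def softmaxCols {N M : ℕ} (lam : ℝ) (U : Matrix (Fin N) (Fin M) ℝ) :
    Matrix (Fin N) (Fin M) ℝ :=
  Matrix.of fun i k => Real.exp (lam * U i k) / ∑ j, Real.exp (lam * U j k)

/-- The Frobenius norm of a real matrix. -/
noncomputable def frobNorm {p q : ℕ} (A : Matrix (Fin p) (Fin q) ℝ) : ℝ :=
  Matrix.frobeniusNormedAddCommGroup.toNorm.norm A

theorem frobNorm_eq {p q : ℕ} (A : Matrix (Fin p) (Fin q) ℝ) :
    frobNorm A = Real.sqrt (∑ i, ∑ j, A i j ^ 2) := by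
  have h := Matrix.frobenius_norm_def A
  simp only [Real.norm_eq_abs, Real.rpow_ofNat, sq_abs] at h
  rw [Real.sqrt_eq_rpow]
  exact h

/-- The parameters of one attention head from token dimension `din` to token dimension `dout`,
with head dimension `dh`. -/
structure AttnHead (din dout : ℕ) where
  dh : ℕ
  WK : Matrix (Fin dh) (Fin din) ℝ
  WQ : Matrix (Fin dh) (Fin din) ℝ
  WV : Matrix (Fin dout) (Fin din) ℝ

namespace AttnHead

/-- The key-query matrix `W_Kᵀ W_Q`. -/
def WKQ {din dout : ℕ} (h : AttnHead din dout) : Matrix (Fin din) (Fin din) ℝ :=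
  h.WK.transpose * h.WQ

/-- The head's output `W_V Z Softmax_lam((W_K Z)ᵀ W_Q Z)` on a sequence of `N` tokens. -/
noncomputable def eval {din dout N : ℕ} (lam : ℝ) (h : AttnHead din dout)
    (Z : Matrix (Fin din) (Fin N) ℝ) : Matrix (Fin dout) (Fin N) ℝ :=
  h.WV * Z * softmaxCols lam ((h.WK * Z).transpose * (h.WQ * Z))

end AttnHead

/-- The `H`-head attention layer: the sum of the outputs of its heads. -/
noncomputable def attnLayer {H din dout N : ℕ} (lam : ℝ) (L : Fin H → AttnHead din dout)
    (Z : Matrix (Fin din) (Fin N) ℝ) : Matrix (Fin dout) (Fin N) ℝ :=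
  ∑ h, (L h).eval lam Z

/-- `AttnStack H d K q` : the parameters of `K` successive `H`-head attention layers, taking token
dimension `d` to token dimension `q` through arbitrary intermediate token dimensions. -/
inductive AttnStack (H d : ℕ) : ℕ → ℕ → Type
  | nil : AttnStack H d 0 d
  | layer {K p q : ℕ} (τ : AttnStack H d K p) (L : Fin H → AttnHead p q) :
      AttnStack H d (K + 1) q

namespace AttnStack

/-- The composition `Attn^{(K)} ∘ ⋯ ∘ Attn^{(1)}`, all layers with inverse temperature `lam`. -/
noncomputable def eval {H d N : ℕ} (lam : ℝ) :
    {K q : ℕ} → AttnStack H d K q → Matrix (Fin d) (Fin N) ℝ → Matrix (Fin q) (Fin N) ℝ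
  | _, _, nil => fun Z => Z
  | _, _, layer τ L => fun Z => attnLayer lam L (τ.eval lam Z)

/-- The largest of all token dimensions and all head dimensions. -/
def width {H d : ℕ} : {K q : ℕ} → AttnStack H d K q → ℕ
  | _, _, nil => d
  | _, q, layer τ L => max τ.width (max q (Finset.univ.sup fun h => (L h).dh))

/-- All key-query matrices have Frobenius norm at most `CKQ`, all value matrices at most `CV`. -/
def NormsLE {H d : ℕ} (CKQ CV : ℝ) : {K q : ℕ} → AttnStack H d K q → Prop
  | _, _, nil => True
  | _, _, layer τ L =>
      τ.NormsLE CKQ CV ∧ ∀ h, frobNorm (L h).WKQ ≤ CKQ ∧ frobNorm (L h).WV ≤ CV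

end AttnStack

/-- The preprocessing layer: append a zero token and then, below the tokens, the one-hot
positional encodings,
`P(X) = [[X, 0], [I_n, 0], [0, 1]] ∈ ℝ^{(d + (n + 1)) × (n + 1)}`. -/
noncomputable def preprocess {d n : ℕ} (X : Matrix (Fin d) (Fin n) ℝ) :
    Matrix (Fin (d + (n + 1))) (Fin (n + 1)) ℝ :=
  Matrix.of fun i j =>
    Fin.addCases
      (fun r : Fin d => Fin.lastCases (motive := fun _ => ℝ) 0 (fun q : Fin n => X r q) j)
      (fun s : Fin (n + 1) => if s = j then (1 : ℝ) else 0) i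

/-- The truncation layer: delete the last token. -/
def truncateLast {q n : ℕ} (Y : Matrix (Fin q) (Fin (n + 1)) ℝ) : Matrix (Fin q) (Fin n) ℝ :=
  Y.submatrix id Fin.castSucc

/-- The class `𝓣(H, W, K, C_KQ, C_V)` of maps `T ∘ Attn^{(K)} ∘ ⋯ ∘ Attn^{(1)} ∘ P` from
`ℝ^{d × n}` to `ℝ^{q × n}`, with inverse temperature `lam`. -/
def transformerClass (n d q : ℕ) (lam : ℝ) (H W K : ℕ) (CKQ CV : ℝ) :
    Set (Matrix (Fin d) (Fin n) ℝ → Matrix (Fin q) (Fin n) ℝ) :=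
  {g | ∃ τ : AttnStack H (d + (n + 1)) K q, τ.width ≤ W ∧ τ.NormsLE CKQ CV ∧
    g = fun X => truncateLast (τ.eval lam (preprocess X))}

/-- `vec(X) = (x₁ᵀ, …, x_nᵀ)`: the columns of `X` stacked into one vector; entry `(i, j)` of `X`
has index `i + d * j`. -/
def stackCols {d n : ℕ} (X : Matrix (Fin d) (Fin n) ℝ) : Fin (n * d) → ℝ :=
  fun k => X.vec (finProdFinEquiv.symm k)

/-!
The transformer follows the network layer by layer. Between layers, every token but the last
carries the whole current hidden vector `u`, the last token carries zero features, and below the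
features all tokens keep their one-hot positions: the state is `tokens (rep u)`.

Two facts keep this going. First, attention with scores that depend on positions only can
rearrange tokens exactly. If query `k` gives score `log 2 / lam` to key `f k` and score `0` to
the other `N - 1`, its softmax weights are `2 / (N + 1)` at `f k` and `1 / (N + 1)` elsewhere, and
a suitable combination with a uniform head leaves the unit vector at `f k` exactly
(`selectMat_eq_softmaxCols`, `NormBudget.select`). Hence affine maps, the preservation of
the positions, the initial gathering of the input tokens and the final distribution of the output
blocks involve no error at all. Columns of a weight matrix are treated by separate heads, which
keeps value matrices of norm `O(B √Wf)` at the cost of `O(Wf)` heads.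

Second, a head whose score and value are both `t` on `n` tokens and `0` on one token returns
`t n e^{lam t} / (n e^{lam t} + 1)`, which differs from `max t 0` by at most `n / lam` for every
real `t` (`abs_softRelu_sub_le`). The error is uniform in `t`, so no bound on the inputs enters.
At the last token the same head is asked to use score `0`; it then returns a linear function of
`t`, which the exact heads cancel (`NormBudget.softRelu_rep`).

Each later affine map amplifies an error by at most `Wf B`, so a network of depth `Kf` incurs a
total error of at most `Kf (Wf B)^Kf n / lam` (`exists_stack_rep`), which fixes `lam`. All norms of
key-query matrices are at most `n + 1`. These choices satisfy the asserted bounds as soon as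
`log (Kf Wf B CX / ε)` is bounded below, that is unless `Kf = Wf = 1`. In that case `d = n = 1`, the
network is an affine function of one variable, and uniform attention represents it exactly
(`exists_transformer_eq_affine`) with key-query matrices zero and `lam` arbitrary.
-/

/-! ### Block matrices and the Frobenius norm -/

/-- The matrix with row blocks `A` and `A'`. -/
def stackRows {p p' N : ℕ} (A : Matrix (Fin p) (Fin N) ℝ) (A' : Matrix (Fin p') (Fin N) ℝ) :
    Matrix (Fin (p + p')) (Fin N) ℝ :=
  Matrix.of fun i j => Fin.addCases (fun r => A r j) (fun s => A' s j) i

/-- The matrix with column blocks `V` and `V'`. -/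
def joinCols {p p' N : ℕ} (V : Matrix (Fin N) (Fin p) ℝ) (V' : Matrix (Fin N) (Fin p') ℝ) :
    Matrix (Fin N) (Fin (p + p')) ℝ :=
  Matrix.of fun i k => Fin.addCases (V i) (V' i) k

section Blocks

variable {p p' q N M : ℕ}

@[simp] lemma stackRows_castAdd (A : Matrix (Fin p) (Fin N) ℝ) (A' : Matrix (Fin p') (Fin N) ℝ)
    (i : Fin p) (j : Fin N) : stackRows A A' (Fin.castAdd p' i) j = A i j := by
  simp [stackRows]

@[simp] lemma stackRows_natAdd (A : Matrix (Fin p) (Fin N) ℝ) (A' : Matrix (Fin p') (Fin N) ℝ)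
    (i : Fin p') (j : Fin N) : stackRows A A' (Fin.natAdd p i) j = A' i j := by
  simp [stackRows]

@[simp] lemma joinCols_castAdd (V : Matrix (Fin N) (Fin p) ℝ) (V' : Matrix (Fin N) (Fin p') ℝ)
    (i : Fin N) (j : Fin p) : joinCols V V' i (Fin.castAdd p' j) = V i j := by
  simp [joinCols]

@[simp] lemma joinCols_natAdd (V : Matrix (Fin N) (Fin p) ℝ) (V' : Matrix (Fin N) (Fin p') ℝ)
    (i : Fin N) (j : Fin p') : joinCols V V' i (Fin.natAdd p j) = V' i j := by
  simp [joinCols]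

lemma stackRows_ext {A B : Matrix (Fin (p + p')) (Fin N) ℝ}
    (h : ∀ i j, A (Fin.castAdd p' i) j = B (Fin.castAdd p' i) j)
    (h' : ∀ i j, A (Fin.natAdd p i) j = B (Fin.natAdd p i) j) : A = B := by
  ext i j
  induction i using Fin.addCases with
  | left i => exact h i j
  | right i => exact h' i j

lemma joinCols_mul_stackRows (V : Matrix (Fin q) (Fin p) ℝ) (V' : Matrix (Fin q) (Fin p') ℝ)
    (A : Matrix (Fin p) (Fin N) ℝ) (A' : Matrix (Fin p') (Fin N) ℝ) :
    joinCols V V' * stackRows A A' = V * A + V' * A' := by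
  ext i j
  simp [Matrix.mul_apply, Fin.sum_univ_add]

lemma stackRows_mul (A : Matrix (Fin p) (Fin N) ℝ) (A' : Matrix (Fin p') (Fin N) ℝ)
    (C : Matrix (Fin N) (Fin M) ℝ) :
    stackRows A A' * C = stackRows (A * C) (A' * C) := by
  apply stackRows_ext <;> intro i j <;> simp [Matrix.mul_apply]

lemma transpose_stackRows_mul (A C : Matrix (Fin p) (Fin N) ℝ) (A' C' : Matrix (Fin p') (Fin N) ℝ) :
    (stackRows A A').transpose * stackRows C C' = A.transpose * C + A'.transpose * C' := by
  ext i j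
  simp [Matrix.mul_apply, Fin.sum_univ_add]

lemma stackRows_add (A C : Matrix (Fin p) (Fin N) ℝ) (A' C' : Matrix (Fin p') (Fin N) ℝ) :
    stackRows A A' + stackRows C C' = stackRows (A + C) (A' + C') := by
  apply stackRows_ext <;> intro i j <;> simp

lemma frobNorm_zero : frobNorm (0 : Matrix (Fin p) (Fin q) ℝ) = 0 := by
  simp [frobNorm_eq]

lemma frobNorm_smul (c : ℝ) (A : Matrix (Fin p) (Fin q) ℝ) :
    frobNorm (c • A) = |c| * frobNorm A := by
  simp only [frobNorm_eq, Matrix.smul_apply, smul_eq_mul, mul_pow, ← Finset.mul_sum]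
  rw [Real.sqrt_mul (sq_nonneg c), Real.sqrt_sq_eq_abs]

lemma frobNorm_stackRows_zero (A : Matrix (Fin p) (Fin N) ℝ) :
    frobNorm (stackRows A (0 : Matrix (Fin p') (Fin N) ℝ)) = frobNorm A := by
  simp [frobNorm_eq, Fin.sum_univ_add]

lemma frobNorm_zero_stackRows (A : Matrix (Fin p') (Fin N) ℝ) :
    frobNorm (stackRows (0 : Matrix (Fin p) (Fin N) ℝ) A) = frobNorm A := by
  simp [frobNorm_eq, Fin.sum_univ_add]

lemma frobNorm_zero_joinCols (A : Matrix (Fin N) (Fin p') ℝ) :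
    frobNorm (joinCols (0 : Matrix (Fin N) (Fin p) ℝ) A) = frobNorm A := by
  simp [frobNorm_eq, Fin.sum_univ_add]

lemma frobNorm_le_of_row_le {P : ℕ} (hp : p ≤ P) {R : ℝ} (hR : 0 ≤ R)
    {A : Matrix (Fin p) (Fin q) ℝ} (h : ∀ i, ∑ j, A i j ^ 2 ≤ R) :
    frobNorm A ≤ Real.sqrt (P * R) := by
  rw [frobNorm_eq]
  apply Real.sqrt_le_sqrt
  calc ∑ i, ∑ j, A i j ^ 2 ≤ ∑ _i : Fin p, R := Finset.sum_le_sum fun i _ => h i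
    _ = p * R := by simp
    _ ≤ P * R := by gcongr

lemma sum_sq_joinCols (V : Matrix (Fin N) (Fin p) ℝ) (V' : Matrix (Fin N) (Fin p') ℝ) (i : Fin N) :
    ∑ k, joinCols V V' i k ^ 2 = ∑ k, V i k ^ 2 + ∑ k, V' i k ^ 2 := by
  simp [Fin.sum_univ_add]

end Blocks

/-! ### Maps realized by one attention layer -/

/-- `In x ↦ Out x` is computed, for all `x`, by one attention layer with `H` heads at inverse
temperature `lam`, whose key-query and value matrices have Frobenius norm at most `CKQ` and `CV`,
and whose head dimensions do not exceed the input token dimension. -/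
def IsAttnLayer {α : Type*} {N din dout : ℕ} (lam CKQ CV : ℝ) (H : ℕ)
    (In : α → Matrix (Fin din) (Fin N) ℝ) (Out : α → Matrix (Fin dout) (Fin N) ℝ) : Prop :=
  ∃ L : Fin H → AttnHead din dout,
    (∀ h, (L h).dh ≤ din ∧ frobNorm (L h).WKQ ≤ CKQ ∧ frobNorm (L h).WV ≤ CV) ∧
    ∀ x, attnLayer lam L (In x) = Out x

namespace IsAttnLayer

variable {α β : Type*} {N din dout dout' : ℕ} {lam CKQ CV : ℝ} {H H' : ℕ}
  {In : α → Matrix (Fin din) (Fin N) ℝ} {Out Out' : α → Matrix (Fin dout) (Fin N) ℝ}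

lemma zero (H : ℕ) (hK : 0 ≤ CKQ) (hV : 0 ≤ CV) :
    IsAttnLayer lam CKQ CV H In (fun _ => (0 : Matrix (Fin dout) (Fin N) ℝ)) := by
  refine ⟨fun _ => ⟨0, 0, 0, 0⟩, fun _ => ⟨Nat.zero_le _, ?_, ?_⟩, fun x => ?_⟩
  · simpa [AttnHead.WKQ, frobNorm_zero] using hK
  · simpa [frobNorm_zero] using hV
  · simp [attnLayer, AttnHead.eval]

lemma add (h : IsAttnLayer lam CKQ CV H In Out) (h' : IsAttnLayer lam CKQ CV H' In Out') :
    IsAttnLayer lam CKQ CV (H + H') In (fun x => Out x + Out' x) := by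
  obtain ⟨L, hL, hE⟩ := h
  obtain ⟨L', hL', hE'⟩ := h'
  refine ⟨Fin.append L L', fun i => ?_, fun x => ?_⟩
  · induction i using Fin.addCases with
    | left i => simpa using hL i
    | right i => simpa using hL' i
  · simp only [← hE, ← hE']
    simp [attnLayer, Fin.sum_univ_add]

lemma congr (h : IsAttnLayer lam CKQ CV H In Out) (h' : ∀ x, Out x = Out' x) :
    IsAttnLayer lam CKQ CV H In Out' := by
  rwa [← funext h']

lemma comp (h : IsAttnLayer lam CKQ CV H In Out) (g : β → α) :
    IsAttnLayer lam CKQ CV H (fun y => In (g y)) (fun y => Out (g y)) := by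
  obtain ⟨L, hL, hE⟩ := h
  exact ⟨L, hL, fun y => hE (g y)⟩

lemma mono (h : IsAttnLayer lam CKQ CV H In Out) (hH : H ≤ H') (hK : 0 ≤ CKQ) (hV : 0 ≤ CV) :
    IsAttnLayer lam CKQ CV H' In Out := by
  obtain ⟨k, rfl⟩ := Nat.exists_eq_add_of_le hH
  exact (h.add (zero k hK hV)).congr fun x => by simp

lemma sum {ι : Type*} (s : Finset ι) {F : ι → α → Matrix (Fin dout) (Fin N) ℝ}
    (hK : 0 ≤ CKQ) (hV : 0 ≤ CV) (h : ∀ a, IsAttnLayer lam CKQ CV H In (F a)) :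
    IsAttnLayer lam CKQ CV (s.card * H) In (fun x => ∑ a ∈ s, F a x) := by
  classical
  induction s using Finset.induction_on with
  | empty => simpa using zero 0 hK hV
  | insert a s ha ih =>
    rw [Finset.card_insert_of_notMem ha, add_mul, one_mul]
    exact (ih.add (h a)).congr fun x => by rw [Finset.sum_insert ha, add_comm]

/-- A single head with prescribed key-query matrix `G` and value matrix `V`; the key matrix is
the identity. -/
lemma single (G : Matrix (Fin din) (Fin din) ℝ) (V : Matrix (Fin dout) (Fin din) ℝ)
    (hG : frobNorm G ≤ CKQ) (hV : frobNorm V ≤ CV) :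
    IsAttnLayer lam CKQ CV 1 In
      (fun x => V * In x * softmaxCols lam ((In x).transpose * (G * In x))) := by
  refine ⟨fun _ => ⟨din, 1, G, V⟩, fun _ => ⟨le_rfl, ?_, hV⟩, fun x => ?_⟩
  · simpa [AttnHead.WKQ] using hG
  · simp [attnLayer, AttnHead.eval]

lemma stackRows_zero (h : IsAttnLayer lam CKQ CV H In Out) :
    IsAttnLayer lam CKQ CV H In
      (fun x => stackRows (Out x) (0 : Matrix (Fin dout') (Fin N) ℝ)) := by
  obtain ⟨L, hL, hE⟩ := h
  refine ⟨fun i => ⟨(L i).dh, (L i).WK, (L i).WQ, stackRows (L i).WV 0⟩,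
    fun i => ⟨(hL i).1, (hL i).2.1, ?_⟩, fun x => ?_⟩
  · simpa [frobNorm_stackRows_zero] using (hL i).2.2
  · simp only [← hE]
    apply stackRows_ext <;> intro i j <;>
      simp [attnLayer, AttnHead.eval, stackRows_mul, Matrix.sum_apply]

lemma zero_stackRows (h : IsAttnLayer lam CKQ CV H In Out) :
    IsAttnLayer lam CKQ CV H In
      (fun x => stackRows (0 : Matrix (Fin dout') (Fin N) ℝ) (Out x)) := by
  obtain ⟨L, hL, hE⟩ := h
  refine ⟨fun i => ⟨(L i).dh, (L i).WK, (L i).WQ, stackRows 0 (L i).WV⟩,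
    fun i => ⟨(hL i).1, (hL i).2.1, ?_⟩, fun x => ?_⟩
  · simpa [frobNorm_zero_stackRows] using (hL i).2.2
  · simp only [← hE]
    apply stackRows_ext <;> intro i j <;>
      simp [attnLayer, AttnHead.eval, stackRows_mul, Matrix.sum_apply]

lemma stack {Out₂ : α → Matrix (Fin dout') (Fin N) ℝ}
    (h : IsAttnLayer lam CKQ CV H In Out) (h' : IsAttnLayer lam CKQ CV H' In Out₂) :
    IsAttnLayer lam CKQ CV (H + H') In (fun x => stackRows (Out x) (Out₂ x)) :=
  (h.stackRows_zero.add h'.zero_stackRows).congr fun x => by simp [stackRows_add]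

end IsAttnLayer

/-! ### Exact rearrangement of tokens by positional attention -/

/-- Feature columns `U` with the one-hot positional encodings appended below. -/
def tokens {w N : ℕ} (U : Matrix (Fin w) (Fin N) ℝ) : Matrix (Fin (w + N)) (Fin N) ℝ :=
  stackRows U 1

/-- The 0-1 matrix whose `k`-th column is the unit vector at `f k`. -/
def selectMat {N : ℕ} (f : Fin N → Fin N) : Matrix (Fin N) (Fin N) ℝ :=
  Matrix.of fun l k => if l = f k then 1 else 0

lemma mul_selectMat {p N : ℕ} (A : Matrix (Fin p) (Fin N) ℝ) (f : Fin N → Fin N) :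
    A * selectMat f = A.submatrix id f := by
  ext i k
  simp [Matrix.mul_apply, selectMat]

lemma frobNorm_selectMat {N : ℕ} (f : Fin N → Fin N) : frobNorm (selectMat f) = Real.sqrt N := by
  rw [frobNorm_eq, Finset.sum_comm]
  simp [selectMat]

lemma softmaxCols_zero {N M : ℕ} (lam : ℝ) :
    softmaxCols lam (0 : Matrix (Fin N) (Fin M) ℝ) = Matrix.of fun _ _ => (1 / N : ℝ) := by
  ext i k
  simp [softmaxCols]

/-- With scores `log 2 / lam` at the selected entries the softmax weights are `2 / (N + 1)` there
and `1 / (N + 1)` elsewhere; subtracting uniform attention recovers the selection exactly. -/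
lemma selectMat_eq_softmaxCols {N : ℕ} {lam : ℝ} (hlam : 0 < lam) (f : Fin N → Fin N) :
    selectMat f = ((N : ℝ) + 1) • softmaxCols lam ((Real.log 2 / lam) • selectMat f) +
      (-(N : ℝ)) • softmaxCols lam (0 : Matrix (Fin N) (Fin N) ℝ) := by
  ext i k
  have hN : (0 : ℝ) < N := by
    have := i.pos
    exact_mod_cast this
  have hexp : ∀ i, Real.exp (lam * (Real.log 2 / lam * selectMat f i k)) =
      1 + if i = f k then (1 : ℝ) else 0 := by
    intro i
    by_cases h : i = f k
    · simp only [selectMat, Matrix.of_apply, h, if_true, mul_one]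
      rw [mul_div_cancel₀ _ hlam.ne', Real.exp_log (by norm_num)]
      norm_num
    · simp [selectMat, h]
  rw [softmaxCols_zero]
  simp only [Matrix.add_apply, Matrix.smul_apply, smul_eq_mul, softmaxCols, Matrix.of_apply, hexp,
    Finset.sum_add_distrib, Finset.sum_ite_eq', Finset.mem_univ, if_true, Finset.sum_const,
    Finset.card_univ, Fintype.card_fin, nsmul_eq_mul, mul_one]
  rw [selectMat, Matrix.of_apply]
  field_simp
  ring

/-- The norm bounds `CKQ` and `CV` leave room for all heads used on `N` tokens: `P` bounds the
token dimensions and `R` the squared Euclidean norm of the rows of the value matrices, before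
these are multiplied by a factor of at most `N + 1`. -/
structure NormBudget (N P : ℕ) (R lam CKQ CV : ℝ) : Prop where
  one_le_lam : 1 ≤ lam
  one_le_R : 1 ≤ R
  key : Real.sqrt N ≤ CKQ
  value : ((N : ℝ) + 1) * Real.sqrt (P * R) ≤ CV
  card_le : N ≤ P

namespace NormBudget

variable {w N dout P : ℕ} {R lam CKQ CV : ℝ}

lemma lam_pos (hb : NormBudget N P R lam CKQ CV) : 0 < lam := by linarith [hb.one_le_lam]

lemma CKQ_nonneg (hb : NormBudget N P R lam CKQ CV) : 0 ≤ CKQ := (Real.sqrt_nonneg _).trans hb.key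

lemma CV_nonneg (hb : NormBudget N P R lam CKQ CV) : 0 ≤ CV := le_trans (by positivity) hb.value

lemma frobNorm_smul_le (hb : NormBudget N P R lam CKQ CV) {p q : ℕ} (hp : p ≤ P)
    {V : Matrix (Fin p) (Fin q) ℝ} (hV : ∀ i, ∑ j, V i j ^ 2 ≤ R) {c : ℝ}
    (hc : |c| ≤ (N : ℝ) + 1) : frobNorm (c • V) ≤ CV := by
  rw [frobNorm_smul]
  have hR : 0 ≤ R := zero_le_one.trans hb.one_le_R
  refine le_trans (mul_le_mul hc (frobNorm_le_of_row_le hp hR hV) ?_ (by positivity)) hb.value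
  rw [frobNorm_eq]
  positivity

lemma positional (S : Matrix (Fin N) (Fin N) ℝ)
    (V : Matrix (Fin dout) (Fin (w + N)) ℝ) (hS : frobNorm S ≤ CKQ) (hV : frobNorm V ≤ CV) :
    IsAttnLayer lam CKQ CV 1 (fun U : Matrix (Fin w) (Fin N) ℝ => tokens U)
      (fun U => V * tokens U * softmaxCols lam S) := by
  refine (IsAttnLayer.single (stackRows 0 (joinCols 0 S)) V ?_ hV).congr fun U => ?_
  · rwa [frobNorm_zero_stackRows, frobNorm_zero_joinCols]
  · congr 2
    rw [stackRows_mul, tokens, joinCols_mul_stackRows, transpose_stackRows_mul]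
    simp

/-- Two heads with position-only scores compute exactly the map that puts at position `k` the
linear image `V z` of the token `z` at position `f k`. -/
lemma select (hb : NormBudget N P R lam CKQ CV) (hP : dout ≤ P)
    {V : Matrix (Fin dout) (Fin (w + N)) ℝ} (hV : ∀ i, ∑ j, V i j ^ 2 ≤ R) (f : Fin N → Fin N) :
    IsAttnLayer lam CKQ CV 2 (fun U : Matrix (Fin w) (Fin N) ℝ => tokens U)
      (fun U => (V * tokens U).submatrix id f) := by
  have hN : (0 : ℝ) ≤ N := Nat.cast_nonneg N
  have hlog : 0 ≤ Real.log 2 / lam := div_nonneg (Real.log_nonneg (by norm_num)) hb.lam_pos.le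
  have hlog1 : Real.log 2 / lam ≤ 1 := by
    rw [div_le_one hb.lam_pos]
    linarith [Real.log_two_lt_d9, hb.one_le_lam]
  have h1 := positional (w := w) (lam := lam) (CKQ := CKQ) ((Real.log 2 / lam) • selectMat f)
    (((N : ℝ) + 1) • V)
    (by
      rw [frobNorm_smul, frobNorm_selectMat, abs_of_nonneg hlog]
      exact (mul_le_of_le_one_left (Real.sqrt_nonneg _) hlog1).trans hb.key)
    (hb.frobNorm_smul_le hP hV (abs_of_nonneg (by positivity)).le)
  have h2 := positional (w := w) (lam := lam) (CKQ := CKQ) (0 : Matrix (Fin N) (Fin N) ℝ)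
    ((-(N : ℝ)) • V) (by rw [frobNorm_zero]; exact hb.CKQ_nonneg)
    (hb.frobNorm_smul_le hP hV (by rw [abs_neg, abs_of_nonneg hN]; linarith))
  refine (h1.add h2).congr fun U => ?_
  rw [← mul_selectMat]
  conv_rhs => rw [selectMat_eq_softmaxCols hb.lam_pos f]
  simp only [Matrix.mul_add, Matrix.smul_mul, Matrix.mul_smul]

/-- The special case of `select` in which the value matrix reads the features only. -/
lemma select_features (hb : NormBudget N P R lam CKQ CV) (hP : dout ≤ P)
    {V : Matrix (Fin dout) (Fin w) ℝ} (hV : ∀ i, ∑ j, V i j ^ 2 ≤ R) (f : Fin N → Fin N) :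
    IsAttnLayer lam CKQ CV 2 (fun U : Matrix (Fin w) (Fin N) ℝ => tokens U)
      (fun U => (V * U).submatrix id f) := by
  refine (hb.select hP (V := joinCols V 0) (fun i => ?_) f).congr fun U => ?_
  · simpa [sum_sq_joinCols] using hV i
  · simp [tokens, joinCols_mul_stackRows]

/-- A matrix that does not depend on the features is produced from the positional encodings. -/
lemma const (hb : NormBudget N P R lam CKQ CV) (hP : dout ≤ P)
    {V : Matrix (Fin dout) (Fin N) ℝ} (hV : ∀ i, ∑ j, V i j ^ 2 ≤ R) :
    IsAttnLayer lam CKQ CV 2 (fun U : Matrix (Fin w) (Fin N) ℝ => tokens U) (fun _ => V) := by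
  refine (hb.select hP (V := joinCols 0 V) (fun i => ?_) id).congr fun U => ?_
  · simpa [sum_sq_joinCols] using hV i
  · simp [tokens, joinCols_mul_stackRows]

lemma sum_sq_one_le (hb : NormBudget N P R lam CKQ CV) {p : ℕ} (i : Fin p) :
    ∑ j, (1 : Matrix (Fin p) (Fin p) ℝ) i j ^ 2 ≤ R := by
  simpa [Matrix.one_apply] using hb.one_le_R

lemma identity (hb : NormBudget N P R lam CKQ CV) (hP : w + N ≤ P) :
    IsAttnLayer lam CKQ CV 2 (fun U : Matrix (Fin w) (Fin N) ℝ => tokens U) tokens :=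
  (hb.select hP hb.sum_sq_one_le id).congr fun U => by simp

lemma withPositions (hb : NormBudget N P R lam CKQ CV) {H : ℕ}
    {F : Matrix (Fin w) (Fin N) ℝ → Matrix (Fin dout) (Fin N) ℝ}
    (h : IsAttnLayer lam CKQ CV H (fun U : Matrix (Fin w) (Fin N) ℝ => tokens U) F) :
    IsAttnLayer lam CKQ CV (H + 2) (fun U : Matrix (Fin w) (Fin N) ℝ => tokens U)
      (fun U => tokens (F U)) :=
  h.stack (hb.const hb.card_le hb.sum_sq_one_le)

end NormBudget

/-! ### Affine layers -/

/-- The feature matrix with column `u` at every position but the last, where it is zero. -/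
def rep {w n : ℕ} (u : Fin w → ℝ) : Matrix (Fin w) (Fin (n + 1)) ℝ :=
  Matrix.of fun i k => if k = Fin.last n then 0 else u i

/-- The matrix `X` with a zero column appended. -/
def padLast {d n : ℕ} (X : Matrix (Fin d) (Fin n) ℝ) : Matrix (Fin d) (Fin (n + 1)) ℝ :=
  Matrix.of fun i j => Fin.lastCases (motive := fun _ => ℝ) 0 (fun l : Fin n => X i l) j

lemma preprocess_eq_tokens {d n : ℕ} (X : Matrix (Fin d) (Fin n) ℝ) :
    preprocess X = tokens (padLast X) := by
  apply stackRows_ext <;> intro i j <;> simp [preprocess, tokens, padLast, Matrix.one_apply]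

namespace NormBudget

variable {w n p P : ℕ} {R lam CKQ CV : ℝ}

lemma const_rep (hb : NormBudget (n + 1) P R lam CKQ CV) (hP : p ≤ P) {B : ℝ}
    {b : Fin p → ℝ} (hbB : ∀ i, |b i| ≤ B) (hR : ((n : ℝ) + 1) * B ^ 2 ≤ R) :
    IsAttnLayer lam CKQ CV 2 (fun U : Matrix (Fin w) (Fin (n + 1)) ℝ => tokens U)
      (fun _ => rep b) := by
  refine hb.const hP fun i => le_trans ?_ hR
  have h1 : b i ^ 2 ≤ B ^ 2 := sq_le_sq' (abs_le.1 (hbB i)).1 (abs_le.1 (hbB i)).2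
  calc ∑ k, rep (n := n) b i k ^ 2 ≤ ∑ _k : Fin (n + 1), B ^ 2 := by
        refine Finset.sum_le_sum fun k _ => ?_
        simp only [rep, Matrix.of_apply]
        split_ifs
        · simpa using sq_nonneg B
        · exact h1
    _ = ((n : ℝ) + 1) * B ^ 2 := by simp

/-- The first affine map: each position attends to each of the `n` input tokens in turn, applying
the corresponding block of columns of `A`. -/
lemma affine_preprocess (hb : NormBudget (n + 1) P R lam CKQ CV) (hP : p ≤ P) {d : ℕ} {B : ℝ}
    {A : Matrix (Fin p) (Fin (n * d)) ℝ} {b : Fin p → ℝ} (hA : ∀ i j, |A i j| ≤ B)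
    (hbB : ∀ i, |b i| ≤ B) (hR : ((n : ℝ) + 1) * B ^ 2 ≤ R) (hR' : (d : ℝ) * B ^ 2 ≤ R) :
    IsAttnLayer lam CKQ CV (n * 2 + 2 + 2) (fun X : Matrix (Fin d) (Fin n) ℝ => preprocess X)
      (fun X => tokens (rep (A.mulVec (stackCols X) + b))) := by
  have h1 := IsAttnLayer.sum (Finset.univ : Finset (Fin n)) hb.CKQ_nonneg hb.CV_nonneg fun j =>
    hb.select_features hP (V := Matrix.of fun i r => A i (finProdFinEquiv (j, r)))
      (fun i => by
        refine le_trans ?_ hR'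
        calc _ ≤ ∑ _r : Fin d, B ^ 2 := Finset.sum_le_sum fun r _ =>
              sq_le_sq' (abs_le.1 (hA _ _)).1 (abs_le.1 (hA _ _)).2
          _ = _ := by simp)
      (fun k : Fin (n + 1) => if k = Fin.last n then Fin.last n else Fin.castSucc j)
  rw [Finset.card_univ, Fintype.card_fin] at h1
  have h2 := (hb.withPositions (h1.add (hb.const_rep hP hbB hR))).comp
    (padLast : Matrix (Fin d) (Fin n) ℝ → _)
  simp only [← preprocess_eq_tokens] at h2
  refine h2.congr fun X => congrArg tokens ?_
  ext i k
  induction k using Fin.lastCases with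
  | last => simp [Matrix.sum_apply, Matrix.mul_apply, padLast, rep]
  | cast k =>
    simp only [Matrix.add_apply, Matrix.sum_apply, Matrix.submatrix_apply, id,
      Fin.castSucc_ne_last, if_false, Matrix.mul_apply, Matrix.of_apply, rep, Pi.add_apply,
      Matrix.mulVec, dotProduct, padLast, Fin.lastCases_castSucc]
    rw [← finProdFinEquiv.sum_comp, Fintype.sum_prod_type]
    simp [stackCols, Matrix.vec]

/-- An affine map applied at every position, one pair of heads for each column of `A`: this keeps
the norms of the value matrices of order `√p` instead of `√(p w)`. -/
lemma affine_rep (hb : NormBudget (n + 1) P R lam CKQ CV) (hP : p ≤ P) {B : ℝ}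
    {A : Matrix (Fin p) (Fin w) ℝ} {b : Fin p → ℝ} (hA : ∀ i j, |A i j| ≤ B)
    (hbB : ∀ i, |b i| ≤ B) (hR : ((n : ℝ) + 1) * B ^ 2 ≤ R) :
    IsAttnLayer lam CKQ CV (w * 2 + 2 + 2) (fun u : Fin w → ℝ => tokens (rep (n := n) u))
      (fun u => tokens (rep (A.mulVec u + b))) := by
  have h1 := IsAttnLayer.sum (Finset.univ : Finset (Fin w)) hb.CKQ_nonneg hb.CV_nonneg fun r =>
    hb.select_features hP (V := Matrix.of fun i r' => if r' = r then A i r else 0)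
      (fun i => by
        refine le_trans ?_ hR
        have h : A i r ^ 2 ≤ B ^ 2 := sq_le_sq' (abs_le.1 (hA _ _)).1 (abs_le.1 (hA _ _)).2
        have hn : (0 : ℝ) ≤ n := Nat.cast_nonneg n
        simp only [Matrix.of_apply, ite_pow, ne_eq, OfNat.ofNat_ne_zero, not_false_eq_true,
          zero_pow, Finset.sum_ite_eq', Finset.mem_univ, if_true]
        nlinarith [sq_nonneg B])
      (id : Fin (n + 1) → Fin (n + 1))
  rw [Finset.card_univ, Fintype.card_fin] at h1
  have h2 := (hb.withPositions (h1.add (hb.const_rep hP hbB hR))).comp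
    (rep : (Fin w → ℝ) → Matrix (Fin w) (Fin (n + 1)) ℝ)
  refine h2.congr fun u => congrArg tokens ?_
  ext i k
  simp only [Matrix.add_apply, Matrix.sum_apply, Matrix.submatrix_apply, id, Matrix.mul_apply,
    Matrix.of_apply, rep, Pi.add_apply, Matrix.mulVec, dotProduct, ite_mul, zero_mul,
    Finset.sum_ite_eq', Finset.mem_univ, if_true]
  split_ifs <;> simp

/-- The last layer: position `j` receives the `j`-th block of a vector known to all tokens but the
last one; all other contributions vanish because they are read off the last, zero, token. -/
lemma distribute (hb : NormBudget (n + 1) P R lam CKQ CV) (hn : 0 < n) {q : ℕ} (hP : q ≤ P) :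
    IsAttnLayer lam CKQ CV (n * 2) (fun y : Fin (n * q) → ℝ => tokens (rep (n := n) y))
      (fun y => padLast (Matrix.of fun i j => y (finProdFinEquiv (j, i)))) := by
  have h1 := IsAttnLayer.sum (Finset.univ : Finset (Fin n)) hb.CKQ_nonneg hb.CV_nonneg fun j =>
    hb.select_features hP
      (V := Matrix.of fun (i : Fin q) r => if r = finProdFinEquiv (j, i) then (1 : ℝ) else 0)
      (fun i => by simpa using hb.one_le_R)
      (fun k : Fin (n + 1) => if k = Fin.castSucc j then 0 else Fin.last n)
  rw [Finset.card_univ, Fintype.card_fin] at h1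
  have h2 := h1.comp (rep : (Fin (n * q) → ℝ) → Matrix (Fin (n * q)) (Fin (n + 1)) ℝ)
  refine h2.congr fun y => ?_
  have h0 : (0 : Fin (n + 1)) ≠ Fin.last n := by
    simpa [Fin.ext_iff] using hn.ne
  ext i k
  simp only [Matrix.sum_apply, Matrix.submatrix_apply, id, Matrix.mul_apply,
    Matrix.of_apply, rep, ite_mul, zero_mul, one_mul, Finset.sum_ite_eq', Finset.mem_univ, if_true,
    padLast]
  induction k using Fin.lastCases with
  | last => simp [(Fin.castSucc_ne_last _).symm]
  | cast k =>
    rw [Finset.sum_eq_single k]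
    · simp [h0]
    · intro j _ hj
      simp [hj.symm]
    · simp

end NormBudget

/-! ### The softmax ReLU -/

/-- The value read at inverse temperature `lam` by a query attending to `n` tokens with score and
value `t` and one token with score and value `0`. -/
noncomputable def softRelu (lam : ℝ) (n : ℕ) (t : ℝ) : ℝ :=
  n * Real.exp (lam * t) * t / (n * Real.exp (lam * t) + 1)

lemma abs_softRelu_sub_le {lam : ℝ} (hlam : 0 < lam) {n : ℕ} (hn : 0 < n) (t : ℝ) :
    |softRelu lam n t - max t 0| ≤ n / lam := by
  have hn1 : (1 : ℝ) ≤ n := by exact_mod_cast hn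
  have hE := Real.exp_pos (lam * t)
  have hD : 0 < n * Real.exp (lam * t) + 1 := by positivity
  rcases le_total 0 t with ht | ht
  · have h : softRelu lam n t - max t 0 = -(t / (n * Real.exp (lam * t) + 1)) := by
      rw [max_eq_left ht, softRelu]
      field_simp
      ring
    rw [h, abs_neg, abs_of_nonneg (by positivity), div_le_div_iff₀ hD hlam]
    have := Real.add_one_le_exp (lam * t)
    nlinarith
  · have h : |softRelu lam n t - max t 0| =
        n * (Real.exp (lam * t) * -t) / (n * Real.exp (lam * t) + 1) := by
      rw [max_eq_right ht, sub_zero, softRelu, abs_div, abs_of_pos hD, abs_mul,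
        abs_of_nonpos ht, abs_of_pos (by positivity)]
      ring
    rw [h, div_le_div_iff₀ hD hlam]
    have h2 : Real.exp (lam * t) * (-(lam * t)) ≤ 1 := by
      have h3 := Real.add_one_le_exp (-(lam * t))
      have h4 : Real.exp (lam * t) * Real.exp (-(lam * t)) = 1 := by
        rw [← Real.exp_add]
        simp
      nlinarith
    have h5 : (0 : ℝ) ≤ n * (n * Real.exp (lam * t)) := by positivity
    nlinarith

namespace NormBudget

variable {w n P : ℕ} {R lam CKQ CV : ℝ}

/-- One head on the `r`-th feature. The score is `t_r` when key and query are both different from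
the last position and `0` otherwise, so the last query averages uniformly. -/
lemma softRelu_head (hb : NormBudget (n + 1) P R lam CKQ CV) (hP : w ≤ P) (r : Fin w) :
    IsAttnLayer lam CKQ CV 1 (fun t : Fin w → ℝ => tokens (rep (n := n) t))
      (fun t => Matrix.of fun i k => if i = r then
        (if k = Fin.last n then n / (n + 1) * t r else softRelu lam n (t r)) else 0) := by
  set G : Matrix (Fin w) (Fin (n + 1)) ℝ :=
    Matrix.of fun i k => if i = r then (if k = Fin.last n then 0 else 1) else 0 with hG
  set V : Matrix (Fin w) (Fin w) ℝ :=
    Matrix.of fun i i' => if i = r then (if i' = r then 1 else 0) else 0 with hV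
  have hVn : frobNorm (joinCols V (0 : Matrix (Fin w) (Fin (n + 1)) ℝ)) ≤ CV := by
    rw [← one_smul ℝ (joinCols V _)]
    refine hb.frobNorm_smul_le hP (fun i => ?_) ?_
    · rw [sum_sq_joinCols]
      by_cases hi : i = r
      · simpa [hV, hi] using hb.one_le_R
      · simpa [hV, hi] using zero_le_one.trans hb.one_le_R
    · rw [abs_one]
      linarith [(n + 1).cast_nonneg (α := ℝ)]
  have hGn : frobNorm (stackRows (joinCols (0 : Matrix (Fin w) (Fin w) ℝ) G)
      (0 : Matrix (Fin (n + 1)) (Fin (w + (n + 1))) ℝ)) ≤ CKQ := by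
    rw [frobNorm_stackRows_zero, frobNorm_zero_joinCols]
    refine le_trans ?_ hb.key
    rw [frobNorm_eq]
    apply Real.sqrt_le_sqrt
    rw [Finset.sum_comm]
    calc _ ≤ ∑ _k : Fin (n + 1), (1 : ℝ) := by
          refine Finset.sum_le_sum fun k _ => ?_
          simp only [hG, Matrix.of_apply, ite_pow, ne_eq, OfNat.ofNat_ne_zero, not_false_eq_true,
            zero_pow, Finset.sum_ite_eq', Finset.mem_univ, if_true, one_pow]
          split_ifs <;> norm_num
      _ = _ := by simp
  refine (IsAttnLayer.single (stackRows (joinCols 0 G) 0) (joinCols V 0) hGn hVn).congr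
    fun t => ?_
  have hscore : (tokens (rep (n := n) t)).transpose *
      (stackRows (joinCols 0 G) (0 : Matrix (Fin (n + 1)) (Fin (w + (n + 1))) ℝ) *
        tokens (rep (n := n) t)) =
      Matrix.of fun j k => if j = Fin.last n then 0 else if k = Fin.last n then 0 else t r := by
    rw [stackRows_mul, tokens, joinCols_mul_stackRows, transpose_stackRows_mul]
    ext j k
    simp only [Matrix.zero_mul, Matrix.mul_one, zero_add, add_zero,
      Matrix.mul_apply, Matrix.transpose_apply, rep, hG, Matrix.of_apply, mul_ite, mul_one,
      mul_zero, Finset.sum_ite_eq', Finset.mem_univ, if_true]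
    split_ifs <;> rfl
  rw [hscore, tokens, joinCols_mul_stackRows]
  ext i k
  by_cases hi : i = r
  · simp only [Matrix.zero_mul, add_zero, Matrix.mul_apply, hV, Matrix.of_apply, hi, if_true, rep,
      ite_mul, one_mul, zero_mul, Finset.sum_ite_eq', Finset.mem_univ, softmaxCols]
    rw [Fin.sum_univ_castSucc]
    simp only [Fin.sum_univ_castSucc, Fin.castSucc_ne_last, if_false, if_true, mul_zero,
      Real.exp_zero, Finset.sum_const, Finset.card_univ, Fintype.card_fin, nsmul_eq_mul, add_zero]
    split_ifs with hk
    · simp only [mul_zero, Real.exp_zero]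
      ring
    · rw [softRelu]
      ring
  · simp [Matrix.mul_apply, hV, hi]

/-- The softmax ReLU of all features at once. At the last position the heads leave a multiple of
the features themselves, which two more heads cancel exactly. -/
lemma softRelu_rep (hb : NormBudget (n + 1) P R lam CKQ CV) (hn : 0 < n) (hP : w ≤ P) :
    IsAttnLayer lam CKQ CV (w * 1 + 2 + 2) (fun t : Fin w → ℝ => tokens (rep (n := n) t))
      (fun t => tokens (rep fun i => softRelu lam n (t i))) := by
  have h1 := IsAttnLayer.sum (Finset.univ : Finset (Fin w)) hb.CKQ_nonneg hb.CV_nonneg fun r =>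
    hb.softRelu_head hP r
  rw [Finset.card_univ, Fintype.card_fin] at h1
  have h2 := (hb.select_features (w := w) hP (V := (-(n / (n + 1) : ℝ)) • 1)
      (fun i => by
        have h : (n / (n + 1) : ℝ) ≤ 1 := by
          rw [div_le_one (by positivity)]
          linarith
        have h' : (0 : ℝ) ≤ n / (n + 1) := by positivity
        have h'' : (n / (n + 1) : ℝ) ^ 2 ≤ R := by nlinarith [hb.one_le_R]
        simpa [Matrix.one_apply, mul_pow] using h'')
      (fun k : Fin (n + 1) => if k = Fin.last n then 0 else Fin.last n)).comp
    (rep : (Fin w → ℝ) → Matrix (Fin w) (Fin (n + 1)) ℝ)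
  have h3 := (hb.const (w := w) hb.card_le hb.sum_sq_one_le).comp
    (rep : (Fin w → ℝ) → Matrix (Fin w) (Fin (n + 1)) ℝ)
  have h0 : (0 : Fin (n + 1)) ≠ Fin.last n := by
    simpa [Fin.ext_iff] using hn.ne
  refine ((h1.add h2).stack h3).congr fun t => congrArg tokens ?_
  ext i k
  simp only [Matrix.add_apply, Matrix.sum_apply, Matrix.of_apply, Finset.sum_ite_eq,
    Finset.mem_univ, if_true, Matrix.submatrix_apply, id, Matrix.smul_mul, Matrix.one_mul,
    Matrix.smul_apply, smul_eq_mul, rep]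
  by_cases hk : k = Fin.last n <;> simp [hk, h0]

end NormBudget

/-! ### Stacks of attention layers -/

/-- `In x ↦ Out x` is computed, for all `x`, by `K` successive attention layers of `H` heads each,
within the width bound `W` and the norm bounds `CKQ` and `CV`. -/
def IsAttnStack {α : Type*} {N din dout : ℕ} (lam CKQ CV : ℝ) (H W K : ℕ)
    (In : α → Matrix (Fin din) (Fin N) ℝ) (Out : α → Matrix (Fin dout) (Fin N) ℝ) : Prop :=
  ∃ τ : AttnStack H din K dout, τ.width ≤ W ∧ τ.NormsLE CKQ CV ∧ ∀ x, τ.eval lam (In x) = Out x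

namespace IsAttnStack

variable {α β : Type*} {N din dmid dout : ℕ} {lam CKQ CV : ℝ} {H W K : ℕ}

lemma nil {In : α → Matrix (Fin din) (Fin N) ℝ} (hd : din ≤ W) :
    IsAttnStack lam CKQ CV H W 0 In In :=
  ⟨.nil, hd, trivial, fun _ => rfl⟩

lemma layer {In : α → Matrix (Fin din) (Fin N) ℝ} {Mid : β → Matrix (Fin dmid) (Fin N) ℝ}
    {Out : β → Matrix (Fin dout) (Fin N) ℝ} {g : α → β}
    (h : IsAttnStack lam CKQ CV H W K In (fun x => Mid (g x)))
    (h' : IsAttnLayer lam CKQ CV H Mid Out) (hm : dmid ≤ W) (ho : dout ≤ W) :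
    IsAttnStack lam CKQ CV H W (K + 1) In (fun x => Out (g x)) := by
  obtain ⟨τ, hW, hN, hE⟩ := h
  obtain ⟨L, hL, hE'⟩ := h'
  refine ⟨.layer τ L, ?_, ⟨hN, fun i => (hL i).2⟩, fun x => ?_⟩
  · simp only [AttnStack.width]
    exact max_le hW (max_le ho (Finset.sup_le fun i _ => (hL i).1.trans hm))
  · simp only [AttnStack.eval, hE, hE']

end IsAttnStack

/-! ### ReLU networks -/

namespace ReLUNet

variable {m : ℕ}

lemma one_le_depth {K p : ℕ} (N : ReLUNet m K p) : 1 ≤ K := by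
  cases N <;> omega

lemma input_le_width {K p : ℕ} (N : ReLUNet m K p) : m ≤ N.width := by
  induction N with
  | affine => exact le_max_left _ _
  | layer N A b ih => exact ih.trans (le_max_left _ _)

lemma output_le_width {K p : ℕ} (N : ReLUNet m K p) : p ≤ N.width := by
  cases N <;> exact le_max_right _ _

lemma WeightsLE.mono {B B' : ℝ} (hB : B ≤ B') {K p : ℕ} {N : ReLUNet m K p}
    (h : N.WeightsLE B) : N.WeightsLE B' := by
  induction N with
  | affine => exact ⟨fun i j => (h.1 i j).trans hB, fun i => (h.2 i).trans hB⟩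
  | layer N A b ih =>
    exact ⟨ih h.1, fun i j => (h.2.1 i j).trans hB, fun i => (h.2.2 i).trans hB⟩

lemma exists_affine {B : ℝ} {K p : ℕ} (N : ReLUNet m K p) (hK : K = 1) (h : N.WeightsLE B) :
    ∃ (A : Matrix (Fin p) (Fin m) ℝ) (b : Fin p → ℝ), (∀ i j, |A i j| ≤ B) ∧ (∀ i, |b i| ≤ B) ∧
      N.eval = fun x => A.mulVec x + b := by
  cases N with
  | affine A b => exact ⟨A, b, h.1, h.2, rfl⟩
  | layer N A b =>
    have := N.one_le_depth
    omega

end ReLUNet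

lemma abs_mulVec_sub_le {p w Wf : ℕ} (hw : w ≤ Wf) {B δ : ℝ} (hδ : 0 ≤ δ)
    (hB : 0 ≤ B) {A : Matrix (Fin p) (Fin w) ℝ} (hA : ∀ i j, |A i j| ≤ B) {u v : Fin w → ℝ}
    (huv : ∀ j, |u j - v j| ≤ δ) (i : Fin p) :
    |A.mulVec u i - A.mulVec v i| ≤ Wf * B * δ := by
  simp only [Matrix.mulVec, dotProduct, ← Finset.sum_sub_distrib, ← mul_sub]
  calc |∑ j, A i j * (u j - v j)| ≤ ∑ j, |A i j * (u j - v j)| := Finset.abs_sum_le_sum_abs _ _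
    _ ≤ ∑ _j : Fin w, B * δ := Finset.sum_le_sum fun j _ => by
        rw [abs_mul]
        exact mul_le_mul (hA i j) (huv j) (abs_nonneg _) hB
    _ = w * B * δ := by simp [mul_assoc]
    _ ≤ Wf * B * δ := by gcongr

/-- A network of depth `K` is followed by `3 K - 1` attention layers whose output carries the
approximate network output at every position but the last. Each softmax ReLU contributes an error
`n / lam`, which every later affine map amplifies by at most `Wf B`. -/
theorem exists_stack_rep {n d Wf : ℕ} (hn : 0 < n) (hd : d ≤ Wf) (hWf : 1 ≤ Wf)
    {R lam CKQ CV B : ℝ} (hB : 1 ≤ B) (hb : NormBudget (n + 1) (Wf + (n + 1)) R lam CKQ CV)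
    (hR : ((n : ℝ) + 1) * B ^ 2 ≤ R) (hR' : (d : ℝ) * B ^ 2 ≤ R)
    {K p : ℕ} (N : ReLUNet (n * d) K p) (hN : N.width ≤ Wf) (hW : N.WeightsLE B) :
    ∃ (k : ℕ) (h : Matrix (Fin d) (Fin n) ℝ → Fin p → ℝ), k + 1 = 3 * K ∧
      IsAttnStack lam CKQ CV (2 * Wf + 2 * n + 4) (Wf + (n + 1)) k
        (fun X : Matrix (Fin d) (Fin n) ℝ => preprocess X) (fun X => tokens (rep (h X))) ∧
      ∀ X i, |h X i - N.eval (stackCols X) i| ≤ K * (Wf * B) ^ K * (n / lam) := by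
  have hnl : 0 ≤ n / lam := div_nonneg (Nat.cast_nonneg n) hb.lam_pos.le
  have hWB : 1 ≤ Wf * B := by
    have : (1 : ℝ) ≤ Wf := by exact_mod_cast hWf
    nlinarith
  induction N with
  | @affine p A b =>
    have hp : p ≤ Wf := (le_max_right _ _).trans hN
    have h0 : IsAttnStack lam CKQ CV (2 * Wf + 2 * n + 4) (Wf + (n + 1)) 0
        (fun X : Matrix (Fin d) (Fin n) ℝ => preprocess X)
        (fun X => tokens (id (padLast X))) := by
      simp only [id, ← preprocess_eq_tokens]
      exact .nil (by omega)
    have h1 := h0.layer ((hb.identity (by omega)).mono (by omega) hb.CKQ_nonneg hb.CV_nonneg)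
      (by omega) (by omega)
    simp only [id, ← preprocess_eq_tokens] at h1
    have h2 := h1.layer (g := id)
      ((hb.affine_preprocess (by omega : p ≤ _) hW.1 hW.2 hR hR').mono (by omega) hb.CKQ_nonneg
        hb.CV_nonneg) (by omega) (by omega)
    refine ⟨2, fun X => A.mulVec (stackCols X) + b, rfl, h2, fun X i => ?_⟩
    simp only [ReLUNet.eval, sub_self, abs_zero]
    positivity
  | @layer K w p N A b ih =>
    have hp : p ≤ Wf := (le_max_right _ _).trans hN
    have hN' : N.width ≤ Wf := (le_max_left _ _).trans hN
    have hw : w ≤ Wf := N.output_le_width.trans hN'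
    obtain ⟨k, h, hk, hs, herr⟩ := ih hN' hW.1
    have h1 := hs.layer (g := h)
      ((hb.softRelu_rep hn (by omega : w ≤ _)).mono (by omega) hb.CKQ_nonneg
      hb.CV_nonneg) (by omega) (by omega)
    have h2 := h1.layer (g := fun X i => softRelu lam n (h X i))
      ((hb.affine_rep (by omega : p ≤ _) hW.2.1 hW.2.2 hR).mono (by omega)
      hb.CKQ_nonneg hb.CV_nonneg) (by omega) (by omega)
    have h3 := h2.layer (g := fun X => rep (A.mulVec (fun i => softRelu lam n (h X i)) + b))
      ((hb.identity (by omega)).mono (by omega) hb.CKQ_nonneg hb.CV_nonneg)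
      (by omega) (by omega)
    refine ⟨k + 3, fun X => A.mulVec (fun i => softRelu lam n (h X i)) + b, by omega, h3,
      fun X i => ?_⟩
    simp only [ReLUNet.eval, Pi.add_apply, add_sub_add_right_eq_sub]
    have hrelu : ∀ j, |softRelu lam n (h X j) - reluVec (N.eval (stackCols X)) j| ≤
        K * (Wf * B) ^ K * (n / lam) + n / lam := by
      intro j
      have e1 := abs_softRelu_sub_le hb.lam_pos hn (h X j)
      have e2 := (abs_max_sub_max_le_abs (h X j) (N.eval (stackCols X) j) 0).trans (herr X j)
      have e3 := abs_sub_le (softRelu lam n (h X j)) (max (h X j) 0)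
        (reluVec (N.eval (stackCols X)) j)
      simp only [reluVec] at e3 ⊢
      linarith
    refine (abs_mulVec_sub_le hw (by positivity) (by linarith) hW.2.1 hrelu i).trans ?_
    have hpow : 1 ≤ (Wf * B) ^ K := one_le_pow₀ hWB
    calc Wf * B * (K * (Wf * B) ^ K * (n / lam) + n / lam)
        ≤ Wf * B * (K * (Wf * B) ^ K * (n / lam) + (Wf * B) ^ K * (n / lam)) := by
          gcongr
          exact le_mul_of_one_le_left hnl hpow
      _ = ((K + 1 : ℕ) : ℝ) * (Wf * B) ^ (K + 1) * (n / lam) := by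
          push_cast
          ring

lemma truncateLast_padLast {q n : ℕ} (Y : Matrix (Fin q) (Fin n) ℝ) :
    truncateLast (padLast Y) = Y := by
  ext i j
  simp [truncateLast, padLast]

/-- The transformer approximation with explicit widths, norms and error; the inputs need not be
bounded. -/
theorem exists_transformer_approx {n d q Wf : ℕ} (hn : 0 < n) (hd : 0 < d)
    {lam B : ℝ} (hB : 1 ≤ B) (hlam : 1 ≤ lam)
    {K : ℕ} (N : ReLUNet (n * d) K (n * q)) (hN : N.width ≤ Wf) (hW : N.WeightsLE B) :
    ∃ g ∈ transformerClass n d q lam (2 * Wf + 2 * n + 4) (Wf + (n + 1)) (3 * K) (n + 1)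
        ((n + 2) * Real.sqrt ((Wf + (n + 1)) * ((d + n + 1) * B ^ 2))),
      ∀ X, ‖stackCols (g X) - N.eval (stackCols X)‖ ≤ K * (Wf * B) ^ K * (n / lam) := by
  have hnd : n * d ≤ Wf := N.input_le_width.trans hN
  have hnq : n * q ≤ Wf := N.output_le_width.trans hN
  have hd' : d ≤ Wf := (Nat.le_mul_of_pos_left d hn).trans hnd
  have hq' : q ≤ Wf := (Nat.le_mul_of_pos_left q hn).trans hnq
  have hn0 : (0 : ℝ) ≤ n := Nat.cast_nonneg n
  have hd0 : (0 : ℝ) ≤ d := Nat.cast_nonneg d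
  have hB2 : 1 ≤ B ^ 2 := one_le_pow₀ hB
  have hb : NormBudget (n + 1) (Wf + (n + 1)) (((d : ℝ) + n + 1) * B ^ 2) lam (n + 1)
      ((n + 2) * Real.sqrt ((Wf + (n + 1)) * ((d + n + 1) * B ^ 2))) := by
    refine ⟨hlam, by nlinarith, ?_, ?_, by omega⟩
    · rw [Real.sqrt_le_left (by positivity)]
      push_cast
      nlinarith
    · push_cast
      rw [show (n : ℝ) + 1 + 1 = n + 2 by ring]
  obtain ⟨k, h, hk, hs, herr⟩ := exists_stack_rep hn hd' (hd.trans_le hd') hB hb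
    (by nlinarith) (by nlinarith) N hN hW
  have h1 := hs.layer (g := h)
      ((hb.distribute hn (by omega : q ≤ _)).mono (by omega) hb.CKQ_nonneg
    hb.CV_nonneg) (by omega) (by omega)
  rw [hk] at h1
  obtain ⟨τ, hτW, hτN, hτ⟩ := h1
  refine ⟨_, ⟨τ, hτW, hτN, rfl⟩, fun X => ?_⟩
  have hlp := hb.lam_pos
  refine (pi_norm_le_iff_of_nonneg (by positivity)).2 fun i => ?_
  simp only [hτ, truncateLast_padLast, Pi.sub_apply, Real.norm_eq_abs]
  convert herr X i using 3
  obtain ⟨⟨j, i⟩, rfl⟩ := finProdFinEquiv.surjective i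
  simp only [stackCols, Equiv.symm_apply_apply, Matrix.vec, Matrix.of_apply]

/-- A single affine map of one real variable is computed exactly by uniform attention, at every
temperature and with vanishing key-query matrices. -/
theorem exists_transformer_eq_affine {q : ℕ} (hq : q ≤ 1) {lam CKQ B : ℝ} (hK : 0 ≤ CKQ)
    (hB : 1 ≤ B) {A : Matrix (Fin (1 * q)) (Fin (1 * 1)) ℝ} {b : Fin (1 * q) → ℝ}
    (hA : ∀ i j, |A i j| ≤ B) (hbB : ∀ i, |b i| ≤ B) :
    ∃ g ∈ transformerClass 1 1 q lam 1 3 3 CKQ (5 * B),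
      ∀ X, stackCols (g X) = A.mulVec (stackCols X) + b := by
  set G : Matrix (Fin (1 + (1 + 1))) (Fin (1 + (1 + 1))) ℝ := 0
  have hG : frobNorm G ≤ CKQ := by
    rw [frobNorm_zero]
    exact hK
  have hCV : Real.sqrt ((3 : ℕ) * (8 * B ^ 2)) ≤ 5 * B := by
    rw [Real.sqrt_le_left (by positivity)]
    push_cast
    nlinarith
  have h1 : frobNorm (1 : Matrix (Fin (1 + (1 + 1))) (Fin (1 + (1 + 1))) ℝ) ≤ 5 * B := by
    refine (frobNorm_le_of_row_le le_rfl (R := 8 * B ^ 2) (by positivity) fun i => ?_).trans hCV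
    simp only [Matrix.one_apply, ite_pow, one_pow, ne_eq, OfNat.ofNat_ne_zero, not_false_eq_true,
      zero_pow, Finset.sum_ite_eq, Finset.mem_univ, if_true]
    nlinarith
  -- Uniform attention over the two tokens halves the sum, whence the factors 2.
  set V : Matrix (Fin q) (Fin (1 + (1 + 1))) ℝ :=
    joinCols (Matrix.of fun i r => 2 * A (finProdFinEquiv (0, i)) (finProdFinEquiv (0, r)))
      (Matrix.of fun i s => if s = 0 then 2 * b (finProdFinEquiv (0, i)) else 0) with hVdef
  have hV : frobNorm V ≤ 5 * B := by
    refine (frobNorm_le_of_row_le (by omega) (R := 8 * B ^ 2) (by positivity) fun i => ?_).trans hCV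
    have e1 := sq_le_sq' (abs_le.1 (hA (finProdFinEquiv (0, i)) (finProdFinEquiv (0, 0)))).1
      (abs_le.1 (hA (finProdFinEquiv (0, i)) (finProdFinEquiv (0, 0)))).2
    have e2 := sq_le_sq' (abs_le.1 (hbB (finProdFinEquiv (0, i)))).1
      (abs_le.1 (hbB (finProdFinEquiv (0, i)))).2
    rw [hVdef, sum_sq_joinCols]
    simp only [Matrix.of_apply, Finset.univ_unique, Fin.default_eq_zero, Finset.sum_singleton,
      ite_pow, ne_eq, OfNat.ofNat_ne_zero, not_false_eq_true, zero_pow, Finset.sum_ite_eq',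
      Finset.mem_univ, if_true]
    nlinarith
  set u : Matrix (Fin (1 + 1)) (Fin (1 + 1)) ℝ := Matrix.of fun _ _ => 1 / 2 with hu
  have huu : u * u = u := by
    ext i j
    simp [hu, Matrix.mul_apply]
  have head : ∀ {α : Type} {p : ℕ} {In : α → Matrix (Fin (1 + (1 + 1))) (Fin (1 + 1)) ℝ}
      (V : Matrix (Fin p) (Fin (1 + (1 + 1))) ℝ), frobNorm V ≤ 5 * B →
      IsAttnLayer lam CKQ (5 * B) 1 In (fun x => V * In x * u) := by
    intro α p In V hV
    refine (IsAttnLayer.single G V hG hV).congr fun x => ?_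
    simp [G, softmaxCols_zero, hu]
  have s0 : IsAttnStack lam CKQ (5 * B) 1 3 0
      (fun X : Matrix (Fin 1) (Fin 1) ℝ => preprocess X) (fun X => preprocess (id X)) :=
    .nil le_rfl
  have s1 := s0.layer (Mid := fun X => preprocess X) (head 1 h1) le_rfl le_rfl
  have s2 := s1.layer (Mid := fun X => 1 * preprocess X * u) (g := id) (head 1 h1) le_rfl le_rfl
  have s3 := s2.layer (Mid := fun X => 1 * (1 * preprocess X * u) * u) (g := id)
    (head V hV) le_rfl (by omega)
  obtain ⟨τ, hτW, hτN, hτ⟩ := s3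
  refine ⟨_, ⟨τ, hτW, hτN, rfl⟩, fun X => ?_⟩
  ext i
  obtain ⟨⟨a, i⟩, rfl⟩ := finProdFinEquiv.surjective i
  obtain rfl : a = 0 := Subsingleton.elim _ _
  simp only [hτ, id, Matrix.one_mul, Matrix.mul_assoc, huu]
  rw [preprocess_eq_tokens, tokens, ← Matrix.mul_assoc, hVdef, joinCols_mul_stackRows]
  have hsum : A.mulVec (stackCols X) (finProdFinEquiv (0, i)) =
      A (finProdFinEquiv (0, i)) (finProdFinEquiv (0, 0)) * X 0 0 := by
    rw [Matrix.mulVec, dotProduct, ← finProdFinEquiv.sum_comp, Fintype.sum_prod_type]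
    simp [stackCols, Matrix.vec]
  rw [Pi.add_apply, hsum]
  simp only [stackCols, Equiv.symm_apply_apply, Matrix.vec, truncateLast, Matrix.submatrix_apply,
    id, Matrix.mul_apply, hu, Matrix.of_apply, Fin.sum_univ_castSucc, Matrix.add_apply]
  have hp0 : padLast X 0 0 = X 0 0 := rfl
  have hp1 : padLast X 0 1 = 0 := rfl
  simp [hp0, hp1]
  ring

/-! ### The approximation theorem -/

theorem mainTheorem1 :
    ∃ (c : ℝ) (a : ℕ), 0 < c ∧
      ∀ (d n q : ℕ), 0 < d → 0 < n →
      ∀ (Kf Wf S : ℕ) (B CX ε : ℝ), 0 < B → 0 < CX → 0 < ε → ε < 1 →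
      ∀ f ∈ reluClass (n * d) (n * q) Kf Wf S B,
      ∃ (H W K : ℕ) (CKQ CV lam : ℝ), 0 < CKQ ∧ 0 < CV ∧ 0 < lam ∧ K = 3 * Kf ∧
        ∃ g ∈ transformerClass n d q lam H W K CKQ CV,
          (∀ X : Matrix (Fin d) (Fin n) ℝ, (∀ i j, X i j ∈ Set.Icc (-CX) CX) →
            ‖stackCols (g X) - f (stackCols X)‖ ≤ ε) ∧
          (1 ≤ CX → 1 ≤ B →
            (H : ℝ) ≤ c * ((d : ℝ) * n) ^ a * Wf ∧
            (W : ℝ) ≤ c * ((d : ℝ) * n) ^ a * Wf ∧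
            CV ≤ c * ((d : ℝ) * n) ^ a * (B * Real.sqrt Wf) ∧
            CKQ ≤ c * ((d : ℝ) * n) ^ a *
              Real.sqrt (Kf * Real.log (Kf * Wf * B * CX / ε)) ∧
            lam ≤ c * ((d : ℝ) * n) ^ a *
              ((Kf : ℝ) ^ 2 * (Wf : ℝ) ^ (Kf + 1) * B ^ Kf *
                Real.log (Kf * Wf * B * CX / ε) / ε)) := by
  refine ⟨9, 2, by norm_num, ?_⟩
  intro d n q hd hn Kf Wf S B CX ε hB hCX hε hε1 f hf
  obtain ⟨N, hNW, hNB, -, rfl⟩ := hf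
  have hKf : 1 ≤ Kf := N.one_le_depth
  have hnd : n * d ≤ Wf := N.input_le_width.trans hNW
  have hWf : 1 ≤ Wf := (Nat.mul_pos hn hd).trans_le hnd
  have hdR : (1 : ℝ) ≤ d := by exact_mod_cast hd
  have hnR : (1 : ℝ) ≤ n := by exact_mod_cast hn
  have hKR : (1 : ℝ) ≤ Kf := by exact_mod_cast hKf
  have hWR : (1 : ℝ) ≤ Wf := by exact_mod_cast hWf
  by_cases hs : (1 ≤ CX ∧ 1 ≤ B) ∧ Kf = 1 ∧ Wf = 1
  · -- Here the logarithm may be arbitrarily close to zero, so no fixed positive value of `CKQ` or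
    -- `lam` would do; but `d = n = 1` and `f` is affine.
    obtain ⟨⟨hCX1, hB1⟩, rfl, rfl⟩ := hs
    obtain rfl : n = 1 := by nlinarith
    obtain rfl : d = 1 := by nlinarith
    have hq : q ≤ 1 := by
      have := N.output_le_width
      omega
    obtain ⟨A, b, hA, hb, hE⟩ := N.exists_affine rfl hNB
    have hlog : 0 < Real.log (((1 : ℕ) : ℝ) * ((1 : ℕ) : ℝ) * B * CX / ε) := by
      apply Real.log_pos
      rw [lt_div_iff₀ hε]
      push_cast
      nlinarith
    set ℓ := Real.log (((1 : ℕ) : ℝ) * ((1 : ℕ) : ℝ) * B * CX / ε) with hℓ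
    obtain ⟨g, hg, hgE⟩ := exists_transformer_eq_affine hq (lam := B * ℓ / ε)
      (Real.sqrt_nonneg ℓ) hB1 hA hb
    refine ⟨1, 3, 3, Real.sqrt ℓ, 5 * B, B * ℓ / ε, Real.sqrt_pos.2 hlog, by positivity,
      by positivity, rfl, g, hg, fun X _ => ?_, fun _ _ => ?_⟩
    · rw [hgE, hE]
      simpa using hε.le
    · have h1 : 0 ≤ B * ℓ / ε := by positivity
      refine ⟨by norm_num, by norm_num, ?_, ?_, ?_⟩
      · norm_num
        linarith
      · norm_num
        linarith [Real.sqrt_nonneg ℓ]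
      · norm_num
        linarith
  · set B' := max B 1 with hB'
    have hB'1 : 1 ≤ B' := le_max_right _ _
    -- The inverse temperature for which the error `Kf (Wf B')^Kf n / lam` is exactly `ε`.
    have hlam : 1 ≤ n * (Kf * (Wf * B') ^ Kf) / ε := by
      rw [le_div_iff₀ hε]
      have h1 : 1 ≤ (Wf * B') ^ Kf := one_le_pow₀ (one_le_mul_of_one_le_of_one_le hWR hB'1)
      have h2 := one_le_mul_of_one_le_of_one_le hnR (one_le_mul_of_one_le_of_one_le hKR h1)
      linarith
    obtain ⟨g, hg, hgE⟩ := exists_transformer_approx hn hd hB'1 hlam N hNW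
      (hNB.mono (le_max_left _ _))
    refine ⟨_, _, _, _, _, _, by positivity, by positivity, by linarith, rfl, g, hg,
      fun X _ => (hgE X).trans_eq ?_, fun hCX1 hB1 => ?_⟩
    · have : (Wf * B') ^ Kf ≠ 0 := by positivity
      field_simp
    · have hBB : B' = B := max_eq_left hB1
      rw [hBB]
      have hdn : (n : ℝ) ≤ d * n := le_mul_of_one_le_left (by linarith) hdR
      have hdn1 : 1 ≤ (d : ℝ) * n := hnR.trans hdn
      have hdn2 : (d : ℝ) * n ≤ (d * n) ^ 2 := by nlinarith
      have hnW : (n : ℝ) ≤ n * Wf := le_mul_of_one_le_right (by linarith) hWR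
      have hWn : (Wf : ℝ) ≤ n * Wf := le_mul_of_one_le_left (by linarith) hnR
      have hnWle : (n : ℝ) * Wf ≤ (d * n) ^ 2 * Wf := by
        gcongr
        exact hdn.trans hdn2
      -- `Kf Wf` is an integer other than `1`, so the argument of the logarithm is at least `2`.
      have hlog : 1 / 2 ≤ Real.log (Kf * Wf * B * CX / ε) := by
        have h2 : (2 : ℝ) ≤ Kf * Wf := by
          have : 2 ≤ Kf * Wf := by
            by_contra hlt
            have h1 : Kf * Wf = 1 := by
              have := Nat.mul_pos hKf hWf
              omega
            exact hs ⟨⟨hCX1, hB1⟩, _root_.mul_eq_one.1 h1⟩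
          exact_mod_cast this
        have h3 : 2 ≤ Kf * Wf * B * CX / ε := by
          rw [le_div_iff₀ hε]
          have := one_le_mul_of_one_le_of_one_le hB1 hCX1
          nlinarith
        have := Real.log_le_log (by norm_num) h3
        linarith [Real.log_two_gt_d9]
      refine ⟨?_, ?_, ?_, ?_, ?_⟩
      · push_cast
        linarith
      · push_cast
        linarith
      · have h1 : Real.sqrt ((Wf + (n + 1)) * ((d + n + 1) * B ^ 2)) ≤
            3 * (d * n) * (B * Real.sqrt Wf) := by
          rw [Real.sqrt_le_left (by positivity)]
          have e1 : (Wf : ℝ) + (n + 1) ≤ 3 * (n * Wf) := by linarith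
          have e2 : (d : ℝ) + n + 1 ≤ 3 * (d * n) := by nlinarith
          calc (Wf + (n + 1)) * ((d + n + 1) * B ^ 2)
              ≤ (3 * (n * Wf)) * ((3 * (d * n)) * B ^ 2) := by gcongr
            _ ≤ (3 * (d * n * Wf)) * ((3 * (d * n)) * B ^ 2) := by gcongr
            _ = (3 * (d * n) * (B * Real.sqrt Wf)) ^ 2 := by
              rw [mul_pow, mul_pow B, Real.sq_sqrt (by linarith)]
              ring
        calc (n + 2) * Real.sqrt ((Wf + (n + 1)) * ((d + n + 1) * B ^ 2))
            ≤ (3 * (d * n)) * (3 * (d * n) * (B * Real.sqrt Wf)) := by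
              gcongr
              linarith
          _ = 9 * (d * n) ^ 2 * (B * Real.sqrt Wf) := by ring
      · have h1 : 1 / 2 ≤ Real.sqrt (Kf * Real.log (Kf * Wf * B * CX / ε)) := by
          apply Real.le_sqrt_of_sq_le
          nlinarith
        have h2 : (0 : ℝ) ≤ (d * n) ^ 2 := by positivity
        nlinarith
      · rw [← mul_div_assoc, div_le_div_iff_of_pos_right hε]
        have e1 : (n : ℝ) ≤ (d * n) ^ 2 := hdn.trans hdn2
        have e2 : (Kf : ℝ) ≤ Kf ^ 2 := by nlinarith
        have e3 : (Wf : ℝ) ^ Kf ≤ Wf ^ (Kf + 1) := pow_le_pow_right₀ hWR (Nat.le_succ _)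
        calc n * (Kf * (Wf * B) ^ Kf) = n * (Kf * Wf ^ Kf * B ^ Kf) := by
              rw [mul_pow]
              ring
          _ ≤ (d * n) ^ 2 * (Kf ^ 2 * Wf ^ (Kf + 1) * B ^ Kf) := by gcongr
          _ ≤ (d * n) ^ 2 * (Kf ^ 2 * Wf ^ (Kf + 1) * B ^ Kf) *
                (9 * Real.log (Kf * Wf * B * CX / ε)) :=
              le_mul_of_one_le_right (by positivity) (by linarith)
          _ = _ := by ring
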